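/- Let $X_1,X_2,\dots$ be independent, identically distributed, continuous real random variables (i.e. $\Pr(X_i=c)=0$ for every real $c$). For a permutation $\sigma$ of $\{1,\dots,k\}$, a consecutive occurrence of $\sigma$ is a block $X_i,X_{i+1},\dots,X_{i+k-1}$ whose entries are in the same relative order as $\sigma_1,\dots,\sigma_k$. Conditionally on the event that $X_1,X_2$ is an occurrence of $21$ (that is, $X_1>X_2$), let $I_{21\to123}$ be the smallest $j\ge 0$ such that $X_1,\dots,X_{2+j}$ contains a consecutive occurrence of $123$ (that is, three consecutive entries $X_i<X_{i+1}<X_{i+2}$), with $I_{21\to123}=\infty$ if there is no such $j$. Then the (conditional) expectation of $I_{21\to123}$ is finite and \[ \mathbb{E}\, I_{21\to123}=\sqrt3\,\tan\!\left(\frac{\sqrt3}{2}+\frac{\pi}{6}\right)-3\approx 6.4554, \] where the decimal value is correct to four decimal places, i.e. within $5\cdot10^{-5}$. -/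

import Mathlib

open MeasureTheory ProbabilityTheory
open scoped ENNReal

/-- The pattern `σ` (one-line notation `σ 0, σ 1, …`) occurs in the sequence `x` at the `k`
consecutive positions `i, i + 1, …, i + k - 1`: these entries are in the same relative order as
the entries of `σ` (in particular they are pairwise distinct). -/
def OccursAt {k : ℕ} (σ : Equiv.Perm (Fin k)) (x : ℕ → ℝ) (i : ℕ) : Prop :=
  ∀ a b : Fin k, x (i + a) < x (i + b) ↔ σ a < σ b

/-- The word `x 0, …, x (n - 1)` formed by the first `n` entries of `x` contains a consecutive
occurrence of the pattern `τ`. -/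
def PrefixContains {l : ℕ} (τ : Equiv.Perm (Fin l)) (x : ℕ → ℝ) (n : ℕ) : Prop :=
  ∃ i : ℕ, i + l ≤ n ∧ OccursAt τ x i

/-- The number of further draws, after the first `k`, needed to see `τ`: the smallest `j` such
that the first `k + j` entries of `x` contain a consecutive occurrence of `τ`, and `⊤` if `τ`
never occurs. -/
noncomputable def furtherDraws {l : ℕ} (k : ℕ) (τ : Equiv.Perm (Fin l)) (x : ℕ → ℝ) : ℕ∞ :=
  sInf ((fun j : ℕ => (j : ℕ∞)) '' {j : ℕ | PrefixContains τ x (k + j)})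

/-- `X 0, X 1, …` is a sequence of independent, identically distributed, continuous (no single
value has positive probability) real random variables. -/
structure IsIIDContinuous {Ω : Type*} [MeasurableSpace Ω] (μ : Measure Ω)
    (X : ℕ → Ω → ℝ) : Prop where
  measurable : ∀ i, Measurable (X i)
  indep : iIndepFun X μ
  identDistrib : ∀ i, IdentDistrib (X i) (X 0) μ μ
  continuous_law : ∀ i, ∀ c : ℝ, μ {ω | X i ω = c} = 0

/-- The event that the sequence `X` starts with an occurrence of `σ`. -/
def startsWith {Ω : Type*} {k : ℕ} (σ : Equiv.Perm (Fin k)) (X : ℕ → Ω → ℝ) : Set Ω :=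
  {ω | OccursAt σ (fun n => X n ω) 0}

/-- The expectation (in `[0, ∞]`) of the number of further draws needed to see `τ`, with respect
to the conditional probability given that the sequence starts with an occurrence of `σ`. -/
noncomputable def expectedFurtherDraws {Ω : Type*} [MeasurableSpace Ω] (μ : Measure Ω)
    (X : ℕ → Ω → ℝ) {k l : ℕ} (σ : Equiv.Perm (Fin k)) (τ : Equiv.Perm (Fin l)) : ℝ≥0∞ :=
  ∫⁻ ω, (furtherDraws k τ (fun n => X n ω) : ℝ≥0∞) ∂(cond μ (startsWith σ X))

/-- The pattern `21`. -/
def pattern21 : Equiv.Perm (Fin 2) := Equiv.swap 0 1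

/-- The pattern `123`. -/
def pattern123 : Equiv.Perm (Fin 3) := Equiv.refl (Fin 3)

/-! ### Numerical bounds -/

/-! Only the relative order of the draws matters, so the cdf transform reduces to independent
uniform draws on [0, 1]. Let D(y) and A(y) be the expected remaining waits when the current value is
y and the last step was down, respectively up. Conditioning on the next draw gives A(y) = 1 + ∫₀^y D
and D(y) = A(y) + ∫_y^1 A, that is, A' = D, D' = D - A, A(0) = 1, A(1) = D(1). The solutions are
damped cosines, written down explicitly.

That they really are expected waits is proved by telescoping. With p n the probability of an initial
descent and no 123 in the first n + 2 entries, and Φ n the integral of the candidate wait over that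
event, the equations say Φ n = p n + Φ (n + 1) (`one_add_lintegral_wait`,
`IsIIDUniform.lintegral_wait_step`). Boundedness of the candidate makes Φ n vanish in the limit, so
∑ p n = Φ 0 (`IsIIDUniform.tsum_measure_descentAvoids`), and ∑ p n is the integral of the waiting
time over the descent event (`setLIntegral_furtherDraws`). Finally Φ 0 = ∫₀¹ (A - 1) = D(0) - 2;
dividing by the probability 1/2 of a descent gives 2 D(0) - 4. -/

theorem alternating_bounds {f : ℕ → ℝ} {l : ℝ} (hf : Antitone f)
    (h : HasSum (fun n => (-1) ^ n * f n) l) (k : ℕ) :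
    ∑ i ∈ Finset.range (2 * k), (-1) ^ i * f i ≤ l ∧
      l ≤ ∑ i ∈ Finset.range (2 * k + 1), (-1) ^ i * f i :=
  ⟨hf.alternating_series_le_tendsto h.tendsto_sum_nat k,
    hf.tendsto_le_alternating_series h.tendsto_sum_nat k⟩

theorem antitone_pow_div_factorial {q : ℝ} (hq0 : 0 ≤ q) (hq1 : q ≤ 1) {g : ℕ → ℕ}
    (hg : Monotone g) : Antitone (fun n : ℕ => q ^ n / (Nat.factorial (g n) : ℝ)) := by
  intro m n hmn
  have h1 : q ^ n ≤ q ^ m := pow_le_pow_of_le_one hq0 hq1 hmn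
  have h2 : (Nat.factorial (g m) : ℝ) ≤ Nat.factorial (g n) := by
    exact_mod_cast Nat.factorial_le (hg hmn)
  have h3 : (0 : ℝ) < Nat.factorial (g m) := by exact_mod_cast Nat.factorial_pos _
  exact div_le_div₀ (pow_nonneg hq0 m) h1 h3 h2

theorem half_sqrt_three_sq : (Real.sqrt 3 / 2) ^ 2 = 3 / 4 := by
  rw [div_pow, Real.sq_sqrt (by norm_num)]; norm_num

theorem cos_half_sqrt_three_bounds :
    ∑ i ∈ Finset.range (2 * 3), (-1) ^ i * ((3 / 4 : ℝ) ^ i / (Nat.factorial (2 * i) : ℝ)) ≤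
      Real.cos (Real.sqrt 3 / 2) ∧ Real.cos (Real.sqrt 3 / 2) ≤
      ∑ i ∈ Finset.range (2 * 3 + 1), (-1) ^ i * ((3 / 4 : ℝ) ^ i / (Nat.factorial (2 * i) : ℝ)) := by
  refine alternating_bounds (antitone_pow_div_factorial (by norm_num) (by norm_num)
    (fun a b h => by omega)) ?_ 3
  have h := Real.hasSum_cos (Real.sqrt 3 / 2)
  simpa only [pow_mul, half_sqrt_three_sq, mul_div_assoc] using h

theorem sin_half_sqrt_three_div_bounds :
    ∑ i ∈ Finset.range (2 * 3), (-1) ^ i * ((3 / 4 : ℝ) ^ i / (Nat.factorial (2 * i + 1) : ℝ)) ≤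
      Real.sin (Real.sqrt 3 / 2) / (Real.sqrt 3 / 2) ∧
      Real.sin (Real.sqrt 3 / 2) / (Real.sqrt 3 / 2) ≤
      ∑ i ∈ Finset.range (2 * 3 + 1),
        (-1) ^ i * ((3 / 4 : ℝ) ^ i / (Nat.factorial (2 * i + 1) : ℝ)) := by
  refine alternating_bounds (antitone_pow_div_factorial (by norm_num) (by norm_num)
    (fun a b h => by omega)) ?_ 3
  have h := (Real.hasSum_sin (Real.sqrt 3 / 2)).div_const (Real.sqrt 3 / 2)
  have h0 : Real.sqrt 3 / 2 ≠ 0 := by positivity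
  refine h.congr_fun ?_
  intro n
  rw [pow_succ, pow_mul, half_sqrt_three_sq]
  field_simp

/-- Writing S = sin x / x and C = cos x at x = √3/2, the addition formulas cancel every √3 and leave
(3S + 2C)/(2C - S). Since x² = 3/4, the alternating series enclose S and C between rationals. -/
theorem sqrt_three_mul_tan_near :
    |(Real.sqrt 3 * Real.tan (Real.sqrt 3 / 2 + Real.pi / 6) - 3) - 6.4554| < 0.00005 := by
  obtain ⟨c1, c2⟩ := cos_half_sqrt_three_bounds
  obtain ⟨s1, s2⟩ := sin_half_sqrt_three_div_bounds
  have hx : Real.sqrt 3 / 2 ≠ 0 := by positivity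
  have hs : Real.sin (Real.sqrt 3 / 2) =
      Real.sin (Real.sqrt 3 / 2) / (Real.sqrt 3 / 2) * (Real.sqrt 3 / 2) := by field_simp
  have h3 : Real.sqrt 3 * Real.sqrt 3 = 3 := Real.mul_self_sqrt (by norm_num)
  rw [Real.tan_eq_sin_div_cos, Real.sin_add, Real.cos_add, Real.cos_pi_div_six,
    Real.sin_pi_div_six, hs]
  set S := Real.sin (Real.sqrt 3 / 2) / (Real.sqrt 3 / 2)
  set C := Real.cos (Real.sqrt 3 / 2)
  norm_num [Finset.sum_range_succ, Nat.factorial] at c1 c2 s1 s2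
  have hpos : 0 < 2 * C - S := by linarith
  have key : Real.sqrt 3 * ((S * (Real.sqrt 3 / 2) * (Real.sqrt 3 / 2) + C * (1 / 2)) /
      (C * (Real.sqrt 3 / 2) - S * (Real.sqrt 3 / 2) * (1 / 2))) =
      (3 * S + 2 * C) / (2 * C - S) := by
    have e1 : C * (Real.sqrt 3 / 2) - S * (Real.sqrt 3 / 2) * (1 / 2) =
        Real.sqrt 3 * ((2 * C - S) / 4) := by ring
    have e2 : S * (Real.sqrt 3 / 2) * (Real.sqrt 3 / 2) + C * (1 / 2) = (3 * S + 2 * C) / 4 := by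
      linear_combination S / 4 * h3
    rw [e1, e2]
    field_simp
  rw [key, abs_lt]
  constructor
  · have : (9.45536 : ℝ) < (3 * S + 2 * C) / (2 * C - S) := by
      rw [lt_div_iff₀ hpos]; linarith
    linarith
  · have : (3 * S + 2 * C) / (2 * C - S) < (9.45544 : ℝ) := by
      rw [div_lt_iff₀ hpos]; linarith
    linarith

/-! ### The probability integral transform -/

theorem continuous_cdf_of_measure_singleton {ν : Measure ℝ} [IsProbabilityMeasure ν]
    (hν : ∀ c, ν {c} = 0) : Continuous (cdf ν) := by
  rw [continuous_iff_continuousAt]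
  intro x
  rw [(cdf ν).mono.continuousAt_iff_leftLim_eq_rightLim, StieltjesFunction.rightLim_eq]
  have h := (cdf ν).measure_singleton x
  rw [measure_cdf, hν x, eq_comm, ENNReal.ofReal_eq_zero] at h
  exact le_antisymm ((cdf ν).mono.leftLim_le le_rfl) (by linarith)

theorem exists_cdf_eq {ν : Measure ℝ} [IsProbabilityMeasure ν]
    (hν : ∀ c, ν {c} = 0) {a : ℝ} (h0 : 0 < a) (h1 : a < 1) : ∃ t, cdf ν t = a := by
  obtain ⟨l, hl⟩ := ((tendsto_cdf_atBot ν).eventually (eventually_le_nhds h0)).exists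
  obtain ⟨r, hr⟩ := ((tendsto_cdf_atTop ν).eventually (eventually_ge_nhds h1)).exists
  exact mem_range_of_exists_le_of_exists_ge (continuous_cdf_of_measure_singleton hν)
    ⟨l, hl⟩ ⟨r, hr⟩

theorem measure_cdf_le {ν : Measure ℝ} [IsProbabilityMeasure ν]
    (hν : ∀ c, ν {c} = 0) {a : ℝ} (h0 : 0 ≤ a) (h1 : a < 1) :
    ν {x | cdf ν x ≤ a} = ENNReal.ofReal a := by
  apply le_antisymm
  -- The cdf may be flat at level a, so the set can extend beyond a given point where the cdf equals
  -- a. It does lie below any point of level b > a; then b decreases to a.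
  · have hb : ∀ b ∈ Set.Ioo a 1, ν {x | cdf ν x ≤ a} ≤ ENNReal.ofReal b := by
      rintro b ⟨hab, hb1⟩
      obtain ⟨t, ht⟩ := exists_cdf_eq hν (h0.trans_lt hab) hb1
      rw [← ht, ofReal_cdf]
      refine measure_mono fun x hx => ?_
      by_contra hxt
      have := monotone_cdf ν (not_le.1 hxt).le
      simp only [Set.mem_ofPred_eq] at hx
      linarith
    have hlim : Filter.Tendsto ENNReal.ofReal (nhdsWithin a (Set.Ioi a))
        (nhds (ENNReal.ofReal a)) :=
      (ENNReal.continuous_ofReal.tendsto a).mono_left nhdsWithin_le_nhds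
    refine ge_of_tendsto hlim ?_
    filter_upwards [Ioo_mem_nhdsGT h1] with b hb' using hb b hb'
  · rcases h0.eq_or_lt with rfl | h0
    · simp
    · obtain ⟨t, ht⟩ := exists_cdf_eq hν h0 h1
      conv_lhs => rw [← ht, ofReal_cdf]
      exact measure_mono fun x hx => (monotone_cdf ν hx).trans ht.le

theorem map_cdf_eq_uniform {ν : Measure ℝ} [IsProbabilityMeasure ν]
    (hν : ∀ c, ν {c} = 0) : ν.map (cdf ν) = volume.restrict (Set.Icc 0 1) := by
  have hm : Measurable (cdf ν) := (monotone_cdf ν).measurable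
  have : IsProbabilityMeasure (ν.map (cdf ν)) := Measure.isProbabilityMeasure_map hm.aemeasurable
  refine Measure.ext_of_Iic _ _ fun a => ?_
  rw [Measure.map_apply hm measurableSet_Iic, Measure.restrict_apply measurableSet_Iic]
  have e : Set.Iic a ∩ Set.Icc (0 : ℝ) 1 = Set.Icc 0 (min a 1) := by
    ext x; simp only [Set.mem_inter_iff, Set.mem_Iic, Set.mem_Icc, le_min_iff]; tauto
  rw [e, Real.volume_Icc, sub_zero]
  change ν {x | cdf ν x ≤ a} = _
  rcases lt_or_ge a 0 with h0 | h0
  · rw [ENNReal.ofReal_of_nonpos (min_le_of_left_le h0.le)]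
    convert measure_empty (μ := ν)
    ext x
    simpa using h0.trans_le (cdf_nonneg ν x)
  rcases lt_or_ge a 1 with h1 | h1
  · rw [min_eq_left h1.le, measure_cdf_le hν h0 h1]
  · rw [min_eq_right h1, ENNReal.ofReal_one]
    convert measure_univ (μ := ν)
    ext x
    simpa using (cdf_le_one ν x).trans h1

/-! ### Independence -/

theorem lintegral_comp_prodMk_of_indepFun {Ω E F : Type*} [MeasurableSpace Ω] [MeasurableSpace E]
    [MeasurableSpace F] {μ : Measure Ω} [IsProbabilityMeasure μ] {V : Ω → E} {W : Ω → F}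
    (hV : Measurable V) (hW : Measurable W) (h : IndepFun V W μ) {f : E × F → ℝ≥0∞}
    (hf : Measurable f) :
    ∫⁻ ω, f (V ω, W ω) ∂μ = ∫⁻ ω, ∫⁻ z, f (V ω, z) ∂(μ.map W) ∂μ := by
  have : IsProbabilityMeasure (μ.map W) := Measure.isProbabilityMeasure_map hW.aemeasurable
  rw [← lintegral_map hf (hV.prodMk hW),
    (indepFun_iff_map_prod_eq_prod_map_map hV.aemeasurable hW.aemeasurable).1 h,
    lintegral_prod _ hf.aemeasurable, lintegral_map hf.lintegral_prod_right' hV]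

/-- A sequence of independent random variables, uniformly distributed on `[0, 1]`. -/
structure IsIIDUniform {Ω : Type*} [MeasurableSpace Ω] (μ : Measure Ω)
    (U : ℕ → Ω → ℝ) : Prop where
  measurable : ∀ i, Measurable (U i)
  indep : iIndepFun U μ
  map_eq : ∀ i, μ.map (U i) = volume.restrict (Set.Icc 0 1)
  mem_Icc : ∀ i ω, U i ω ∈ Set.Icc (0 : ℝ) 1

theorem IsIIDContinuous.isIIDUniform_cdf {Ω : Type*} [MeasurableSpace Ω] {μ : Measure Ω}
    [IsProbabilityMeasure μ] {X : ℕ → Ω → ℝ} (hX : IsIIDContinuous μ X) :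
    IsIIDUniform μ (fun i ω => cdf (μ.map (X 0)) (X i ω)) := by
  have : IsProbabilityMeasure (μ.map (X 0)) :=
    Measure.isProbabilityMeasure_map (hX.measurable 0).aemeasurable
  have hm : Measurable (cdf (μ.map (X 0))) := (monotone_cdf _).measurable
  have hs : ∀ c, μ.map (X 0) {c} = 0 := fun c => by
    rw [Measure.map_apply (hX.measurable 0) (measurableSet_singleton c)]
    exact hX.continuous_law 0 c
  refine ⟨fun i => hm.comp (hX.measurable i), hX.indep.comp (fun _ => cdf (μ.map (X 0)))
    fun _ => hm, fun i => ?_, fun i ω => ⟨cdf_nonneg _ _, cdf_le_one _ _⟩⟩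
  calc μ.map (fun ω => cdf (μ.map (X 0)) (X i ω))
      = (μ.map (X i)).map (cdf (μ.map (X 0))) := (Measure.map_map hm (hX.measurable i)).symm
    _ = volume.restrict (Set.Icc 0 1) := by
      rw [(hX.identDistrib i).map_eq, map_cdf_eq_uniform hs]

theorem IsIIDUniform.ae_ne {Ω : Type*} [MeasurableSpace Ω] {μ : Measure Ω}
    [IsProbabilityMeasure μ] {U : ℕ → Ω → ℝ} (hU : IsIIDUniform μ U) {i j : ℕ} (hij : i ≠ j) :
    ∀ᵐ ω ∂μ, U i ω ≠ U j ω := by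
  have hd : MeasurableSet {p : ℝ × ℝ | p.1 = p.2} := measurableSet_eq_fun measurable_fst
    measurable_snd
  have h := lintegral_comp_prodMk_of_indepFun (hU.measurable i) (hU.measurable j)
    (hU.indep.indepFun hij) (measurable_one.indicator hd)
  have hz : ∀ x : ℝ, ∫⁻ z, {p : ℝ × ℝ | p.1 = p.2}.indicator (1 : ℝ × ℝ → ℝ≥0∞) (x, z)
      ∂(μ.map (U j)) = 0 := by
    intro x
    rw [hU.map_eq]
    refine lintegral_eq_zero_of_ae_eq_zero ?_
    filter_upwards [compl_mem_ae_iff.2 (measure_singleton (μ := volume.restrict (Set.Icc 0 1)) x)]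
      with z hz
    simpa [Set.indicator_apply] using fun e : x = z => hz e.symm
  simp only [hz, lintegral_zero] at h
  have h' := (lintegral_eq_zero_iff ((measurable_one.indicator hd).comp
    ((hU.measurable i).prodMk (hU.measurable j)))).1 h
  filter_upwards [h'] with ω hω e
  simp [e] at hω

/-- The cdf is monotone but perhaps not strictly; order could be lost only through ties of
transformed values, which almost surely do not occur. -/
theorem IsIIDContinuous.ae_lt_iff_cdf_lt {Ω : Type*} [MeasurableSpace Ω] {μ : Measure Ω}
    [IsProbabilityMeasure μ] {X : ℕ → Ω → ℝ} (hX : IsIIDContinuous μ X) :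
    ∀ᵐ ω ∂μ, ∀ i j, X i ω < X j ω ↔
      cdf (μ.map (X 0)) (X i ω) < cdf (μ.map (X 0)) (X j ω) := by
  have h : ∀ᵐ ω ∂μ, ∀ i j, i ≠ j →
      cdf (μ.map (X 0)) (X i ω) ≠ cdf (μ.map (X 0)) (X j ω) := by
    rw [ae_all_iff]; intro i; rw [ae_all_iff]; intro j
    by_cases hij : i = j
    · exact Filter.Eventually.of_forall fun ω h => absurd hij h
    · filter_upwards [hX.isIIDUniform_cdf.ae_ne hij] with ω hω _ using hω
  filter_upwards [h] with ω hω i j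
  constructor
  · intro hlt
    refine lt_of_le_of_ne (monotone_cdf _ hlt.le) (hω i j ?_)
    rintro rfl
    exact lt_irrefl _ hlt
  · exact fun hlt => (monotone_cdf _).reflect_lt hlt

/-! ### The expected waiting times as functions of the current value

`waitDescent y` and `waitAscent y` are the expected numbers of draws until `123` is completed when
the current value is `y` and the last step was a descent, respectively an ascent. -/

/-- The phase is π/6 at y = 1, so evenness of cosine gives A(1) = D(1); the denominator in the two
waits normalizes A(0) = 1. -/
noncomputable def waitAngle (y : ℝ) : ℝ := Real.sqrt 3 / 2 * y + (Real.pi / 6 - Real.sqrt 3 / 2)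

noncomputable def waitDescent (y : ℝ) : ℝ :=
  Real.exp (y / 2) * Real.cos (waitAngle y) / Real.cos (Real.sqrt 3 / 2 + Real.pi / 6)

noncomputable def waitAscent (y : ℝ) : ℝ :=
  Real.exp (y / 2) * Real.cos (waitAngle y - Real.pi / 3) /
    Real.cos (Real.sqrt 3 / 2 + Real.pi / 6)

theorem sqrt_three_bounds : 1.7 < Real.sqrt 3 ∧ Real.sqrt 3 < 1.74 :=
  ⟨Real.lt_sqrt_of_sq_lt (by norm_num), (Real.sqrt_lt' (by norm_num)).2 (by norm_num)⟩

theorem cos_sqrt_three_add_pos : 0 < Real.cos (Real.sqrt 3 / 2 + Real.pi / 6) := by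
  have h := sqrt_three_bounds
  have hp := Real.pi_gt_d2
  apply Real.cos_pos_of_mem_Ioo
  constructor <;> linarith

theorem hasDerivAt_waitAngle (y : ℝ) : HasDerivAt waitAngle (Real.sqrt 3 / 2) y :=
  (((hasDerivAt_id y).const_mul (Real.sqrt 3 / 2)).add_const
    (Real.pi / 6 - Real.sqrt 3 / 2)).congr_deriv (mul_one _)

theorem hasDerivAt_exp_half (y : ℝ) :
    HasDerivAt (fun y : ℝ => Real.exp (y / 2)) (Real.exp (y / 2) * (1 / 2)) y :=
  ((hasDerivAt_id y).div_const 2).exp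

/-- Differentiating exp(y/2) cos θ advances the phase by π/3, as 1/2 + i√3/2 = exp(iπ/3); and cos(θ
+ π/3) = cos θ - cos(θ - π/3). -/
theorem hasDerivAt_waitDescent (y : ℝ) :
    HasDerivAt waitDescent (waitDescent y - waitAscent y) y := by
  have h := ((hasDerivAt_exp_half y).mul (hasDerivAt_waitAngle y).cos).div_const
    (Real.cos (Real.sqrt 3 / 2 + Real.pi / 6))
  refine h.congr_deriv ?_
  rw [waitDescent, waitAscent, Real.cos_sub, Real.cos_pi_div_three, Real.sin_pi_div_three]
  ring

theorem hasDerivAt_waitAscent (y : ℝ) : HasDerivAt waitAscent (waitDescent y) y := by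
  have h := ((hasDerivAt_exp_half y).mul ((hasDerivAt_waitAngle y).sub_const (Real.pi / 3)).cos
    ).div_const (Real.cos (Real.sqrt 3 / 2 + Real.pi / 6))
  refine h.congr_deriv ?_
  rw [waitDescent, Real.cos_sub, Real.sin_sub, Real.cos_pi_div_three, Real.sin_pi_div_three]
  have h3 : Real.sqrt 3 * Real.sqrt 3 = 3 := Real.mul_self_sqrt (by norm_num)
  linear_combination (Real.exp (y / 2) * Real.cos (waitAngle y) /
    Real.cos (Real.sqrt 3 / 2 + Real.pi / 6) / 4) * h3

theorem continuous_waitDescent : Continuous waitDescent :=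
  continuous_iff_continuousAt.2 fun y => (hasDerivAt_waitDescent y).continuousAt

theorem continuous_waitAscent : Continuous waitAscent :=
  continuous_iff_continuousAt.2 fun y => (hasDerivAt_waitAscent y).continuousAt

theorem waitAscent_zero : waitAscent 0 = 1 := by
  have e : waitAngle 0 - Real.pi / 3 = -(Real.sqrt 3 / 2 + Real.pi / 6) := by
    rw [waitAngle]; ring
  rw [waitAscent, e, Real.cos_neg]
  simpa using div_self cos_sqrt_three_add_pos.ne'

theorem waitAscent_one : waitAscent 1 = waitDescent 1 := by
  have e : waitAngle 1 = Real.pi / 6 := by rw [waitAngle]; ring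
  have e' : Real.pi / 6 - Real.pi / 3 = -(Real.pi / 6) := by ring
  rw [waitAscent, waitDescent, e, e', Real.cos_neg]

theorem waitDescent_zero :
    waitDescent 0 = 1 / 2 + Real.sqrt 3 / 2 * Real.tan (Real.sqrt 3 / 2 + Real.pi / 6) := by
  have e : waitAngle 0 = Real.pi / 3 - (Real.sqrt 3 / 2 + Real.pi / 6) := by
    rw [waitAngle]; ring
  have h := cos_sqrt_three_add_pos.ne'
  rw [waitDescent, e, Real.cos_sub, Real.cos_pi_div_three, Real.sin_pi_div_three,
    Real.tan_eq_sin_div_cos, zero_div, Real.exp_zero, one_mul, add_div, mul_div_cancel_right₀ _ h,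
    mul_div_assoc]

theorem waitDescent_nonneg {y : ℝ} (hy : y ∈ Set.Icc (0 : ℝ) 1) : 0 ≤ waitDescent y := by
  obtain ⟨h0, h1⟩ := hy
  have h := sqrt_three_bounds
  have hp := Real.pi_gt_d2
  have hc : 0 ≤ Real.cos (waitAngle y) := by
    apply Real.cos_nonneg_of_mem_Icc
    rw [waitAngle]
    constructor <;> nlinarith
  have := cos_sqrt_three_add_pos
  rw [waitDescent]
  positivity

theorem waitAscent_nonneg {y : ℝ} (hy : y ∈ Set.Icc (0 : ℝ) 1) : 0 ≤ waitAscent y := by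
  obtain ⟨h0, h1⟩ := hy
  have h := sqrt_three_bounds
  have hp := Real.pi_gt_d2
  have hc : 0 ≤ Real.cos (waitAngle y - Real.pi / 3) := by
    apply Real.cos_nonneg_of_mem_Icc
    rw [waitAngle]
    constructor <;> nlinarith
  have := cos_sqrt_three_add_pos
  rw [waitAscent]
  positivity

theorem lintegral_Ioc_deriv {f f' : ℝ → ℝ} {a b : ℝ} (hab : a ≤ b)
    (hf : ∀ x, HasDerivAt f (f' x) x) (hc : Continuous f') (h0 : ∀ x ∈ Set.Icc a b, 0 ≤ f' x) :
    ∫⁻ x in Set.Ioc a b, ENNReal.ofReal (f' x) = ENNReal.ofReal (f b - f a) := by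
  rw [← intervalIntegral.integral_eq_sub_of_hasDerivAt (fun x _ => hf x)
    (hc.intervalIntegrable a b), intervalIntegral.integral_of_le hab,
    ofReal_integral_eq_lintegral_ofReal]
  · exact (hc.integrableOn_Icc).mono_set Set.Ioc_subset_Icc_self
  · filter_upwards [ae_restrict_mem measurableSet_Ioc] with x hx
    exact h0 x (Set.Ioc_subset_Icc_self hx)

theorem one_le_waitAscent {y : ℝ} (hy : y ∈ Set.Icc (0 : ℝ) 1) : 1 ≤ waitAscent y := by
  have h := intervalIntegral.integral_eq_sub_of_hasDerivAt (a := 0) (b := y)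
    (fun x _ => hasDerivAt_waitAscent x) (continuous_waitDescent.intervalIntegrable 0 y)
  have h0 : 0 ≤ ∫ x in (0 : ℝ)..y, waitDescent x :=
    intervalIntegral.integral_nonneg hy.1 fun x hx => waitDescent_nonneg ⟨hx.1, hx.2.trans hy.2⟩
  rw [h, waitAscent_zero] at h0
  linarith

theorem lintegral_waitDescent {y : ℝ} (hy : y ∈ Set.Icc (0 : ℝ) 1) :
    ∫⁻ z in Set.Ioc 0 y, ENNReal.ofReal (waitDescent z) = ENNReal.ofReal (waitAscent y - 1) := by
  rw [lintegral_Ioc_deriv hy.1 hasDerivAt_waitAscent continuous_waitDescent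
    fun x hx => waitDescent_nonneg ⟨hx.1, hx.2.trans hy.2⟩, waitAscent_zero]

theorem lintegral_waitAscent {y : ℝ} (hy : y ∈ Set.Icc (0 : ℝ) 1) :
    ∫⁻ z in Set.Ioc y 1, ENNReal.ofReal (waitAscent z) =
      ENNReal.ofReal (waitDescent y - waitAscent y) := by
  have hd : ∀ x, HasDerivAt (fun x => waitAscent x - waitDescent x) (waitAscent x) x := fun x =>
    ((hasDerivAt_waitAscent x).sub (hasDerivAt_waitDescent x)).congr_deriv (by ring)
  rw [lintegral_Ioc_deriv hy.2 hd continuous_waitAscent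
    fun x hx => waitAscent_nonneg ⟨hy.1.trans hx.1, hx.2⟩, waitAscent_one]
  congr 1; ring

theorem waitAscent_le_waitDescent {y : ℝ} (hy : y ∈ Set.Icc (0 : ℝ) 1) :
    waitAscent y ≤ waitDescent y := by
  have hd : ∀ x, HasDerivAt (fun x => waitAscent x - waitDescent x) (waitAscent x) x := fun x =>
    ((hasDerivAt_waitAscent x).sub (hasDerivAt_waitDescent x)).congr_deriv (by ring)
  have h := intervalIntegral.integral_eq_sub_of_hasDerivAt (a := y) (b := 1)
    (fun x _ => hd x) (continuous_waitAscent.intervalIntegrable y 1)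
  have h0 : 0 ≤ ∫ x in y..1, waitAscent x :=
    intervalIntegral.integral_nonneg hy.2 fun x hx => waitAscent_nonneg ⟨hy.1.trans hx.1, hx.2⟩
  rw [h, waitAscent_one] at h0
  linarith

theorem lintegral_waitAscent_sub_one :
    ∫⁻ y in Set.Ioc (0 : ℝ) 1, ENNReal.ofReal (waitAscent y - 1) =
      ENNReal.ofReal (waitDescent 0 - 2) := by
  have hd : ∀ x, HasDerivAt (fun x => waitAscent x - waitDescent x - x) (waitAscent x - 1) x :=
    fun x => (((hasDerivAt_waitAscent x).sub (hasDerivAt_waitDescent x)).sub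
      (hasDerivAt_id x)).congr_deriv (by ring)
  rw [lintegral_Ioc_deriv zero_le_one hd (continuous_waitAscent.sub continuous_const)
    fun x hx => sub_nonneg.2 (one_le_waitAscent hx), waitAscent_one, waitAscent_zero]
  congr 1; ring

theorem lintegral_Icc_ite {y : ℝ} (hy : y ∈ Set.Icc (0 : ℝ) 1) (f g : ℝ → ℝ≥0∞) :
    ∫⁻ z in Set.Icc (0 : ℝ) 1, (if y < z then f z else g z) =
      (∫⁻ z in Set.Ioc 0 y, g z) + ∫⁻ z in Set.Ioc y 1, f z := by
  rw [setLIntegral_congr (Ioc_ae_eq_Icc (μ := volume)).symm, ← Set.Ioc_union_Ioc_eq_Ioc hy.1 hy.2,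
    lintegral_union measurableSet_Ioc (Set.Ioc_disjoint_Ioc_of_le le_rfl)]
  congr 1
  · exact setLIntegral_congr_fun measurableSet_Ioc fun z hz => if_neg (not_lt.2 hz.2)
  · exact setLIntegral_congr_fun measurableSet_Ioc fun z hz => if_pos hz.1

/-- The expected waiting time when the last two values are `x` and `y`. -/
noncomputable def wait (x y : ℝ) : ℝ≥0∞ :=
  ENNReal.ofReal (if x < y then waitAscent y else waitDescent y)

theorem measurable_wait : Measurable (fun p : ℝ × ℝ => wait p.1 p.2) :=
  (Measurable.ite (measurableSet_lt measurable_fst measurable_snd)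
    (continuous_waitAscent.measurable.comp measurable_snd)
    (continuous_waitDescent.measurable.comp measurable_snd)).ennreal_ofReal

/-- First-step equation: the next draw costs 1, and nothing remains if it completes 123. -/
theorem one_add_lintegral_wait (x : ℝ) {y : ℝ} (hy : y ∈ Set.Icc (0 : ℝ) 1) :
    1 + ∫⁻ z in Set.Icc (0 : ℝ) 1, (if x < y ∧ y < z then 0 else wait y z) = wait x y := by
  have h1 := one_le_waitAscent hy
  have h2 := waitAscent_le_waitDescent hy
  have hd : ∫⁻ z in Set.Ioc 0 y, wait y z = ENNReal.ofReal (waitAscent y - 1) := by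
    rw [← lintegral_waitDescent hy]
    exact setLIntegral_congr_fun measurableSet_Ioc fun z hz => by
      simp only [wait, if_neg (not_lt.2 hz.2)]
  have ha : ∫⁻ z in Set.Ioc y 1, wait y z = ENNReal.ofReal (waitDescent y - waitAscent y) := by
    rw [← lintegral_waitAscent hy]
    exact setLIntegral_congr_fun measurableSet_Ioc fun z hz => by
      simp only [wait, if_pos hz.1]
  by_cases hxy : x < y
  · simp only [hxy, true_and]
    rw [lintegral_Icc_ite hy, hd, lintegral_zero, add_zero, ← ENNReal.ofReal_one,
      ← ENNReal.ofReal_add zero_le_one (by linarith), wait, if_pos hxy]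
    congr 1; ring
  · have e : ∀ z, (if x < y ∧ y < z then 0 else wait y z) =
        if y < z then wait y z else wait y z := fun z => by simp [hxy]
    simp only [e]
    rw [lintegral_Icc_ite hy, hd, ha, ← ENNReal.ofReal_one,
      ← ENNReal.ofReal_add (by linarith) (by linarith),
      ← ENNReal.ofReal_add zero_le_one (by linarith), wait, if_neg hxy]
    congr 1; ring

theorem exists_wait_le : ∃ C : ℝ≥0∞, C ≠ ∞ ∧ ∀ x, ∀ y ∈ Set.Icc (0 : ℝ) 1, wait x y ≤ C := by
  obtain ⟨C, hC⟩ := isCompact_Icc.exists_bound_of_continuousOn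
    (continuous_waitDescent.continuousOn (s := Set.Icc (0 : ℝ) 1))
  refine ⟨ENNReal.ofReal C, ENNReal.ofReal_ne_top, fun x y hy => ENNReal.ofReal_le_ofReal ?_⟩
  have h := (le_abs_self _).trans (hC y hy)
  split_ifs
  · exact (waitAscent_le_waitDescent hy).trans h
  · exact h

/-! ### Patterns -/

/-- The sequence `x` starts with a descent and its first `n + 2` entries avoid `123`. -/
def DescentAvoids (n : ℕ) (x : ℕ → ℝ) : Prop :=
  x 1 < x 0 ∧ ∀ i < n, ¬(x i < x (i + 1) ∧ x (i + 1) < x (i + 2))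

theorem descentAvoids_zero (x : ℕ → ℝ) : DescentAvoids 0 x ↔ x 1 < x 0 := by
  simp [DescentAvoids]

theorem descentAvoids_succ (n : ℕ) (x : ℕ → ℝ) : DescentAvoids (n + 1) x ↔
    DescentAvoids n x ∧ ¬(x n < x (n + 1) ∧ x (n + 1) < x (n + 2)) := by
  simp only [DescentAvoids, Nat.lt_succ_iff_lt_or_eq, or_imp, forall_and, forall_eq, and_assoc]

theorem descentAvoids_congr {n : ℕ} {x y : ℕ → ℝ} (h : ∀ i < n + 2, x i = y i) :
    DescentAvoids n x ↔ DescentAvoids n y := by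
  unfold DescentAvoids
  rw [h 0 (by omega), h 1 (by omega)]
  refine and_congr_right fun _ => forall₂_congr fun i hi => ?_
  rw [h i (by omega), h (i + 1) (by omega), h (i + 2) (by omega)]

theorem descentAvoids_congr_lt {x y : ℕ → ℝ} (h : ∀ i j, x i < x j ↔ y i < y j) (n : ℕ) :
    DescentAvoids n x ↔ DescentAvoids n y := by
  simp only [DescentAvoids, h]

theorem measurableSet_descentAvoids (n : ℕ) : MeasurableSet {x : ℕ → ℝ | DescentAvoids n x} := by
  have hlt : ∀ i j : ℕ, MeasurableSet {x : ℕ → ℝ | x i < x j} := fun i j =>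
    measurableSet_lt (measurable_pi_apply i) (measurable_pi_apply j)
  induction n with
  | zero => simpa only [descentAvoids_zero] using hlt 1 0
  | succ n ih =>
    simp only [descentAvoids_succ]
    exact ih.inter ((hlt n (n + 1)).inter (hlt (n + 1) (n + 2))).compl

theorem occursAt_pattern21 (x : ℕ → ℝ) : OccursAt pattern21 x 0 ↔ x 1 < x 0 := by
  simp [OccursAt, pattern21, Fin.forall_fin_two]
  exact le_of_lt

theorem occursAt_pattern123 (x : ℕ → ℝ) (i : ℕ) :
    OccursAt pattern123 x i ↔ x i < x (i + 1) ∧ x (i + 1) < x (i + 2) := by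
  constructor
  · intro h
    exact ⟨(h 0 1).2 (by decide), (h 1 2).2 (by decide)⟩
  · rintro ⟨h1, h2⟩ a b
    have h3 := h1.trans h2
    fin_cases a <;> fin_cases b <;> simp [pattern123, h1, h2, h3, h1.le, h2.le, h3.le]

theorem prefixContains_pattern123 (x : ℕ → ℝ) (n : ℕ) :
    PrefixContains pattern123 x (2 + n) ↔ ∃ i < n, x i < x (i + 1) ∧ x (i + 1) < x (i + 2) := by
  refine exists_congr fun i => and_congr (by omega) (occursAt_pattern123 x i)

theorem PrefixContains.mono {l : ℕ} {τ : Equiv.Perm (Fin l)} {x : ℕ → ℝ} {m n : ℕ}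
    (h : PrefixContains τ x m) (hmn : m ≤ n) : PrefixContains τ x n :=
  let ⟨i, hi, ho⟩ := h
  ⟨i, hi.trans hmn, ho⟩

open Classical in
-- Counts the n at which the pattern is still absent; once present, it stays in every longer prefix.
theorem furtherDraws_eq_tsum {l : ℕ} (k : ℕ) (τ : Equiv.Perm (Fin l)) (x : ℕ → ℝ) :
    (furtherDraws k τ x : ℝ≥0∞) = ∑' n : ℕ, if PrefixContains τ x (k + n) then 0 else 1 := by
  by_cases h : ∃ n, PrefixContains τ x (k + n)
  · have hiff : ∀ n, PrefixContains τ x (k + n) ↔ Nat.find h ≤ n := fun n =>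
      ⟨fun hn => Nat.find_min' h hn, fun hn => (Nat.find_spec h).mono (by omega)⟩
    have hf : furtherDraws k τ x = (Nat.find h : ℕ∞) := by
      apply IsLeast.csInf_eq
      refine ⟨⟨_, Nat.find_spec h, rfl⟩, ?_⟩
      rintro _ ⟨n, hn, rfl⟩
      exact Nat.cast_le.2 (Nat.find_min' h hn)
    rw [hf, tsum_eq_sum (s := Finset.range (Nat.find h)), Finset.sum_congr rfl
      (g := fun _ => (1 : ℝ≥0∞))]
    · rw [Finset.sum_const, Finset.card_range, nsmul_one, ENat.toENNReal_coe]
    · intro n hn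
      exact if_neg fun hc => (Finset.mem_range.1 hn).not_ge ((hiff n).1 hc)
    · intro n hn
      exact if_pos ((hiff n).2 (not_lt.1 fun h => hn (Finset.mem_range.2 h)))
  · have he : {j : ℕ | PrefixContains τ x (k + j)} = ∅ :=
      Set.eq_empty_of_forall_notMem fun n hn => h ⟨n, hn⟩
    have h' : ∀ n, ¬PrefixContains τ x (k + n) := fun n hn => h ⟨n, hn⟩
    rw [furtherDraws, he, Set.image_empty, sInf_empty, ENat.toENNReal_top]
    simp only [h', if_false]
    exact (ENNReal.tsum_const_eq_top_of_ne_zero one_ne_zero).symm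

theorem mem_startsWith_pattern21 {Ω : Type*} {X : ℕ → Ω → ℝ} {ω : Ω} :
    ω ∈ startsWith pattern21 X ↔ X 1 ω < X 0 ω := by
  rw [startsWith, Set.mem_ofPred_eq, occursAt_pattern21]

theorem setLIntegral_furtherDraws {Ω : Type*} [MeasurableSpace Ω] (μ : Measure Ω)
    {X : ℕ → Ω → ℝ} (hX : ∀ i, Measurable (X i)) :
    ∫⁻ ω in startsWith pattern21 X, (furtherDraws 2 pattern123 (fun n => X n ω) : ℝ≥0∞) ∂μ =
      ∑' n, μ {ω | DescentAvoids n (fun i => X i ω)} := by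
  classical
  have hs : MeasurableSet (startsWith pattern21 X) := by
    simp only [startsWith, occursAt_pattern21]
    exact measurableSet_lt (hX 1) (hX 0)
  have hm : ∀ n, MeasurableSet {ω | DescentAvoids n (fun i => X i ω)} := fun n =>
    measurable_pi_lambda _ hX (measurableSet_descentAvoids n)
  rw [← lintegral_indicator hs]
  have e : ∀ ω, (startsWith pattern21 X).indicator
      (fun ω => (furtherDraws 2 pattern123 (fun n => X n ω) : ℝ≥0∞)) ω =
      ∑' n, {ω | DescentAvoids n (fun i => X i ω)}.indicator 1 ω := by
    intro ω
    by_cases hω : X 1 ω < X 0 ω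
    · rw [Set.indicator_of_mem (mem_startsWith_pattern21.2 hω), furtherDraws_eq_tsum]
      refine tsum_congr fun n => ?_
      rw [Set.indicator_apply]
      simp only [Set.mem_ofPred_eq, DescentAvoids, hω, true_and, prefixContains_pattern123,
        Pi.one_apply]
      by_cases hc : ∃ i < n, X i ω < X (i + 1) ω ∧ X (i + 1) ω < X (i + 2) ω
      · rw [if_pos hc, if_neg]
        push Not
        obtain ⟨i, hi, h1, h2⟩ := hc
        exact ⟨i, hi, h1, h2⟩
      · rw [if_neg hc, if_pos]
        exact fun i hi h => hc ⟨i, hi, h⟩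
    · rw [Set.indicator_of_notMem fun h => hω (mem_startsWith_pattern21.1 h), eq_comm,
        ENNReal.tsum_eq_zero]
      exact fun n => Set.indicator_of_notMem (fun h => hω h.1) _
  simp only [e]
  rw [lintegral_tsum fun n => (measurable_one.indicator (hm n)).aemeasurable]
  exact tsum_congr fun n => lintegral_indicator_one (hm n)

/-! ### One further draw -/

/-- Padding the past with zeros keeps it a sequence, so `DescentAvoids` applies to it unchanged. -/
theorem IsIIDUniform.indepFun_truncate {Ω : Type*} [MeasurableSpace Ω] {μ : Measure Ω}
    {U : ℕ → Ω → ℝ} (hU : IsIIDUniform μ U) (m : ℕ) :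
    IndepFun (fun ω i => if i < m then U i ω else 0) (U m) μ := by
  have h := hU.indep.indepFun_finset (Finset.range m) {m} (by simp) hU.measurable
  let φ : (Finset.range m → ℝ) → ℕ → ℝ := fun v i =>
    if h : i ∈ Finset.range m then v ⟨i, h⟩ else 0
  have hφ : Measurable φ := by
    refine measurable_pi_lambda _ fun i => ?_
    by_cases hi : i ∈ Finset.range m
    · simpa only [φ, hi, dite_true] using measurable_pi_apply _
    · simpa only [φ, hi, dite_false] using measurable_const
  have h' := h.comp hφ (measurable_pi_apply (⟨m, by simp⟩ : ({m} : Finset ℕ)))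
  have e : (fun ω i => if i < m then U i ω else 0) =
      φ ∘ fun ω (i : Finset.range m) => U i ω := by
    ext ω i
    simp [φ]
  rw [e]
  exact h'

open Classical in
theorem IsIIDUniform.lintegral_wait_step {Ω : Type*} [MeasurableSpace Ω] {μ : Measure Ω}
    [IsProbabilityMeasure μ] {U : ℕ → Ω → ℝ} (hU : IsIIDUniform μ U) (n : ℕ) :
    ∫⁻ ω in {ω | DescentAvoids n (fun i => U i ω)}, wait (U n ω) (U (n + 1) ω) ∂μ =
      μ {ω | DescentAvoids n (fun i => U i ω)} +
      ∫⁻ ω in {ω | DescentAvoids (n + 1) (fun i => U i ω)},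
        wait (U (n + 1) ω) (U (n + 2) ω) ∂μ := by
  have hm : ∀ n, MeasurableSet {ω | DescentAvoids n (fun i => U i ω)} := fun n =>
    measurable_pi_lambda _ hU.measurable (measurableSet_descentAvoids n)
  let V : Ω → ℕ → ℝ := fun ω i => if i < n + 2 then U i ω else 0
  have hV : Measurable V := by
    refine measurable_pi_lambda _ fun i => ?_
    by_cases hi : i < n + 2
    · simpa only [V, hi, if_true] using hU.measurable i
    · simpa only [V, hi, if_false] using measurable_const
  let s : Set ((ℕ → ℝ) × ℝ) :=
    {p | DescentAvoids n p.1 ∧ ¬(p.1 n < p.1 (n + 1) ∧ p.1 (n + 1) < p.2)}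
  have hc : ∀ i, Measurable fun p : (ℕ → ℝ) × ℝ => p.1 i := fun i =>
    (measurable_pi_apply i).comp measurable_fst
  have hs : MeasurableSet s :=
    (measurable_fst (measurableSet_descentAvoids n)).inter
      ((measurableSet_lt (hc n) (hc (n + 1))).inter
        (measurableSet_lt (hc (n + 1)) measurable_snd)).compl
  have hf : Measurable (s.indicator fun p => wait (p.1 (n + 1)) p.2) :=
    (measurable_wait.comp ((hc (n + 1)).prodMk measurable_snd)).indicator hs
  have key := lintegral_comp_prodMk_of_indepFun hV (hU.measurable (n + 2))
    (hU.indepFun_truncate (n + 2)) hf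
  have hVn : ∀ ω, V ω n = U n ω := fun ω => if_pos (by omega)
  have hVn1 : ∀ ω, V ω (n + 1) = U (n + 1) ω := fun ω => if_pos (by omega)
  have hVD : ∀ ω, DescentAvoids n (V ω) ↔ DescentAvoids n (fun i => U i ω) := fun ω =>
    descentAvoids_congr fun i hi => if_pos hi
  have hl : ∀ ω, s.indicator (fun p => wait (p.1 (n + 1)) p.2) (V ω, U (n + 2) ω) =
      {ω | DescentAvoids (n + 1) (fun i => U i ω)}.indicator
        (fun ω => wait (U (n + 1) ω) (U (n + 2) ω)) ω := by
    intro ω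
    simp only [s, Set.indicator_apply, Set.mem_ofPred_eq, hVn, hVn1, hVD, descentAvoids_succ]
  have hr : ∀ ω, {ω | DescentAvoids n (fun i => U i ω)}.indicator
        (fun ω => wait (U n ω) (U (n + 1) ω)) ω =
      {ω | DescentAvoids n (fun i => U i ω)}.indicator 1 ω +
      ∫⁻ z, s.indicator (fun p => wait (p.1 (n + 1)) p.2) (V ω, z) ∂(μ.map (U (n + 2))) := by
    intro ω
    by_cases hω : DescentAvoids n (fun i => U i ω)
    · have hω' : ω ∈ {ω | DescentAvoids n (fun i => U i ω)} := hω
      rw [Set.indicator_of_mem hω', Set.indicator_of_mem hω', hU.map_eq,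
        ← one_add_lintegral_wait (U n ω) (hU.mem_Icc (n + 1) ω)]
      simp only [s, Set.indicator_apply, Set.mem_ofPred_eq, hVn, hVn1, hVD, hω, true_and,
        ite_not, Pi.one_apply]
    · have hω' : ω ∉ {ω | DescentAvoids n (fun i => U i ω)} := hω
      rw [Set.indicator_of_notMem hω', Set.indicator_of_notMem hω']
      simp [s, hVD, hω]
  rw [← lintegral_indicator (hm n), ← lintegral_indicator (hm (n + 1))]
  simp only [hr]
  rw [lintegral_add_left (measurable_one.indicator (hm n)), lintegral_indicator_one (hm n), ← key]
  simp only [hl]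

theorem IsIIDUniform.tsum_measure_descentAvoids {Ω : Type*} [MeasurableSpace Ω] {μ : Measure Ω}
    [IsProbabilityMeasure μ] {U : ℕ → Ω → ℝ} (hU : IsIIDUniform μ U) :
    ∑' n, μ {ω | DescentAvoids n (fun i => U i ω)} =
      ∫⁻ ω in {ω | DescentAvoids 0 (fun i => U i ω)}, wait (U 0 ω) (U 1 ω) ∂μ := by
  set p : ℕ → ℝ≥0∞ := fun n => μ {ω | DescentAvoids n (fun i => U i ω)}
  set Φ : ℕ → ℝ≥0∞ := fun n =>
    ∫⁻ ω in {ω | DescentAvoids n (fun i => U i ω)}, wait (U n ω) (U (n + 1) ω) ∂μ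
  have hsum : ∀ N, (∑ n ∈ Finset.range N, p n) + Φ N = Φ 0 := by
    intro N
    induction N with
    | zero => simp
    | succ N ih =>
      rw [Finset.sum_range_succ, add_assoc, ← ih]
      exact congrArg _ (hU.lintegral_wait_step N).symm
  obtain ⟨C, hC, hwait⟩ := exists_wait_le
  -- This bound serves twice: at 0 it makes Φ finite, hence p summable; then p → 0 forces Φ → 0.
  have hbound : ∀ N, Φ N ≤ C * p N := by
    intro N
    refine (lintegral_mono fun ω => hwait _ _ (hU.mem_Icc (N + 1) ω)).trans ?_
    rw [setLIntegral_const]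
  have htop : Φ 0 ≠ ∞ :=
    ((hbound 0).trans_lt (ENNReal.mul_lt_top hC.lt_top (measure_lt_top μ _))).ne
  have hle : ∑' n, p n ≤ Φ 0 := by
    rw [ENNReal.tsum_eq_iSup_nat]
    exact iSup_le fun N => (hsum N).symm ▸ le_self_add
  have hp0 : Filter.Tendsto p Filter.atTop (nhds 0) :=
    ENNReal.tendsto_atTop_zero_of_tsum_ne_top (ne_top_of_le_ne_top htop hle)
  have hΦ0 : Filter.Tendsto Φ Filter.atTop (nhds 0) := by
    refine tendsto_of_tendsto_of_tendsto_of_le_of_le tendsto_const_nhds ?_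
      (fun _ => zero_le) hbound
    simpa using ENNReal.Tendsto.const_mul hp0 (Or.inr hC)
  have hlim := (ENNReal.tendsto_nat_tsum p).add hΦ0
  simp only [hsum, add_zero] at hlim
  exact tendsto_nhds_unique hlim tendsto_const_nhds

/-! ### The first two draws -/

theorem IsIIDUniform.setLIntegral_descent {Ω : Type*} [MeasurableSpace Ω] {μ : Measure Ω}
    [IsProbabilityMeasure μ] {U : ℕ → Ω → ℝ} (hU : IsIIDUniform μ U) {f : ℝ → ℝ≥0∞}
    (hf : Measurable f) :
    ∫⁻ ω in {ω | DescentAvoids 0 (fun i => U i ω)}, f (U 1 ω) ∂μ =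
      ∫⁻ x in Set.Ioc (0 : ℝ) 1, ∫⁻ y in Set.Ioc 0 x, f y := by
  have hs : MeasurableSet {p : ℝ × ℝ | p.2 ≤ p.1} := measurableSet_le measurable_snd measurable_fst
  have hF : Measurable ({p : ℝ × ℝ | p.2 ≤ p.1}.indicator fun p => f p.2) :=
    (hf.comp measurable_snd).indicator hs
  have key := lintegral_comp_prodMk_of_indepFun (hU.measurable 0) (hU.measurable 1)
    (hU.indep.indepFun zero_ne_one) hF
  simp only [descentAvoids_zero]
  rw [← lintegral_indicator (measurableSet_lt (hU.measurable 1) (hU.measurable 0))]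
  -- Ties are null, so the strict descent may be relaxed to the complement of x < z used in
  -- `lintegral_Icc_ite`.
  have hae : ∀ᵐ ω ∂μ, {ω | U 1 ω < U 0 ω}.indicator (fun ω => f (U 1 ω)) ω =
      {p : ℝ × ℝ | p.2 ≤ p.1}.indicator (fun p => f p.2) (U 0 ω, U 1 ω) := by
    filter_upwards [hU.ae_ne zero_ne_one] with ω hω
    have : U 1 ω < U 0 ω ↔ U 1 ω ≤ U 0 ω := ⟨le_of_lt, fun h => lt_of_le_of_ne h hω.symm⟩
    simp only [Set.indicator_apply, Set.mem_ofPred_eq, this]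
  rw [lintegral_congr_ae hae, key, hU.map_eq, ← lintegral_map (f := fun x =>
      ∫⁻ z in Set.Icc (0 : ℝ) 1, {p : ℝ × ℝ | p.2 ≤ p.1}.indicator (fun p => f p.2) (x, z))
      hF.lintegral_prod_right' (hU.measurable 0), hU.map_eq,
    setLIntegral_congr (Ioc_ae_eq_Icc (μ := volume) (a := (0 : ℝ)) (b := 1)).symm]
  refine setLIntegral_congr_fun measurableSet_Ioc fun x hx => ?_
  have h := lintegral_Icc_ite (y := x) ⟨hx.1.le, hx.2⟩ (fun _ => 0) f
  rw [lintegral_zero, add_zero] at h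
  rw [← h]
  refine lintegral_congr fun z => ?_
  simp only [Set.indicator_apply, Set.mem_ofPred_eq, ← not_lt, ite_not]

theorem IsIIDUniform.measure_descent {Ω : Type*} [MeasurableSpace Ω] {μ : Measure Ω}
    [IsProbabilityMeasure μ] {U : ℕ → Ω → ℝ} (hU : IsIIDUniform μ U) :
    μ {ω | DescentAvoids 0 (fun i => U i ω)} = 2⁻¹ := by
  have h := hU.setLIntegral_descent (f := fun _ => 1) measurable_const
  simp only [setLIntegral_one, Real.volume_Ioc, sub_zero] at h
  have hd : ∀ x : ℝ, HasDerivAt (fun x : ℝ => x ^ 2 / 2) x x := fun x =>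
    ((hasDerivAt_pow 2 x).div_const 2).congr_deriv (by simp)
  rw [h, lintegral_Ioc_deriv zero_le_one hd continuous_id fun x hx => hx.1]
  norm_num
  rw [one_div, ENNReal.ofReal_inv_of_pos two_pos]
  norm_num

theorem IsIIDUniform.lintegral_wait_descent {Ω : Type*} [MeasurableSpace Ω] {μ : Measure Ω}
    [IsProbabilityMeasure μ] {U : ℕ → Ω → ℝ} (hU : IsIIDUniform μ U) :
    ∫⁻ ω in {ω | DescentAvoids 0 (fun i => U i ω)}, wait (U 0 ω) (U 1 ω) ∂μ =
      ENNReal.ofReal (waitDescent 0 - 2) := by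
  have hm : MeasurableSet {ω | DescentAvoids 0 (fun i => U i ω)} :=
    measurable_pi_lambda _ hU.measurable (measurableSet_descentAvoids 0)
  rw [setLIntegral_congr_fun hm (g := fun ω => ENNReal.ofReal (waitDescent (U 1 ω)))
    fun ω hω => by
      rw [Set.mem_ofPred_eq, descentAvoids_zero] at hω
      simp only [wait, if_neg (not_lt.2 hω.le)],
    hU.setLIntegral_descent continuous_waitDescent.measurable.ennreal_ofReal,
    ← lintegral_waitAscent_sub_one]
  exact setLIntegral_congr_fun measurableSet_Ioc fun x hx => lintegral_waitDescent ⟨hx.1.le, hx.2⟩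

theorem mainTheorem10 {Ω : Type*} [MeasurableSpace Ω] (μ : Measure Ω) [IsProbabilityMeasure μ]
    (X : ℕ → Ω → ℝ) (hX : IsIIDContinuous μ X) :
    expectedFurtherDraws μ X pattern21 pattern123 =
        ENNReal.ofReal (Real.sqrt 3 * Real.tan (Real.sqrt 3 / 2 + Real.pi / 6) - 3) ∧
      |(Real.sqrt 3 * Real.tan (Real.sqrt 3 / 2 + Real.pi / 6) - 3) - 6.4554| < 0.00005 := by
  refine ⟨?_, sqrt_three_mul_tan_near⟩
  have hU := hX.isIIDUniform_cdf
  have hXU : ∀ n, μ {ω | DescentAvoids n (fun i => X i ω)} =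
      μ {ω | DescentAvoids n (fun i => cdf (μ.map (X 0)) (X i ω))} := by
    intro n
    refine measure_congr ?_
    filter_upwards [hX.ae_lt_iff_cdf_lt] with ω hω
    exact propext (descentAvoids_congr_lt hω n)
  have hs : startsWith pattern21 X = {ω | DescentAvoids 0 (fun i => X i ω)} := by
    simp only [startsWith, occursAt_pattern21, descentAvoids_zero]
  rw [expectedFurtherDraws, ProbabilityTheory.cond, lintegral_smul_measure,
    setLIntegral_furtherDraws μ hX.measurable,
    hs]
  simp only [hXU]
  rw [hU.tsum_measure_descentAvoids, hU.lintegral_wait_descent, hU.measure_descent, inv_inv,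
    waitDescent_zero, smul_eq_mul, ← ENNReal.ofReal_ofNat, ← ENNReal.ofReal_mul zero_le_two]
  congr 1
  ring
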